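/- Let $\mathscr{A}$ be a Banach $^*$-algebra, that is, a complex (not necessarily unital) $^*$-algebra with a complete submultiplicative norm; the involution is not assumed to be continuous. Let $\mathscr{M}$ be a left ideal of $\mathscr{A}$ and $f:\mathscr{M}\to\mathbb{C}$ a linear functional, and assume that for some constant $C\geq 0$ $$|f(a)|^2\leq C\cdot f(a^*a)\qquad\text{for all } a\in\mathscr{M}$$ (in particular $C\cdot f(a^*a)$ is real). Then the following hold. For every $a\in\mathscr{M}$ the conjugate-linear functional $Aa:x\mapsto f(x^*a)$ on $\mathscr{A}$ is continuous, so that $A:a\mapsto Aa$ is a linear operator from $\mathscr{M}\subseteq\mathscr{A}$ into the space of continuous conjugate-linear functionals on $\mathscr{A}$. It is positive, i.e. $(Aa)(a)=f(a^*a)\geq 0$ for all $a\in\mathscr{M}$, and there is a constant $K\geq 0$ with $\|Aa\|^2\leq K\cdot (Aa)(a)$ for all $a\in\mathscr{M}$. Hence $\langle Aa, Ab\rangle_A:=(Aa)(b)=f(b^*a)$ is a well-defined inner product on the range of $A$ (linear in the first variable); let $H_A$ be the Hilbert space completion of the range of $A$ with respect to it. There is a $^*$-representation $\pi_A:\mathscr{A}\to\mathscr{B}(H_A)$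 with $\pi_A(x)(Aa)=A(xa)$ for all $x\in\mathscr{A}$, $a\in\mathscr{M}$, and there is a cyclic vector $\zeta_A\in H_A$ of $\pi_A$, i.e. $\{\pi_A(x)\zeta_A : x\in\mathscr{A}\}$ is dense in $H_A$, such that $$f(a)=\langle\pi_A(a)\zeta_A,\zeta_A\rangle_A\qquad\text{for all } a\in\mathscr{M}.$$ -/

import Mathlib

open scoped ComplexOrder ComplexConjugate InnerProductSpace

noncomputable section

namespace KreinVonNeumann

section Operators

variable {E : Type*} [NormedAddCommGroup E] [NormedSpace ℂ E]

/-- The topological antidual of `E`: the continuous conjugate-linear functionals on `E`. -/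
abbrev Antidual (E : Type*) [NormedAddCommGroup E] [NormedSpace ℂ E] : Type _ := E →L⋆[ℂ] ℂ

/-- A (not necessarily everywhere defined) linear operator `A` from `E` into its antidual is
positive if `(A x)(x) ≥ 0` for all `x` in the domain of `A`. -/
def IsPositiveOp (A : E →ₗ.[ℂ] Antidual E) : Prop :=
  ∀ x : A.domain, 0 ≤ A x (x : E)

/-- The Schwarz-type inequality `‖A x‖² ≤ K · (A x)(x)` for some constant `K ≥ 0`. -/
def IsSchwarzBounded (A : E →ₗ.[ℂ] Antidual E) : Prop :=
  ∃ K : ℝ, 0 ≤ K ∧ ∀ x : A.domain, ((‖A x‖ ^ 2 : ℝ) : ℂ) ≤ (K : ℂ) * A x (x : E)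

/-- A positive operator is symmetric. -/
theorem IsPositiveOp.symm {A : E →ₗ.[ℂ] Antidual E} (hA : IsPositiveOp A) (x y : A.domain) :
    A x (y : E) = conj (A y (x : E)) := by
  have him : ∀ z : A.domain, (A z (z : E)).im = 0 := fun z =>
    ((Complex.nonneg_iff.1 (hA z)).2).symm
  have h1 := him (x + y)
  have h2 := him (Complex.I • x + y)
  have hx := him x
  have hy := him y
  simp [LinearPMap.map_add, LinearPMap.map_smul] at h1 h2
  rw [hx, hy] at h1 h2
  apply Complex.ext
  · simp
    linarith
  · simp
    linarith

/-- The range `ran A` of a positive operator `A` satisfying the Schwarz-type inequality, as a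
type of its own. It is to carry the inner product `⟨A x, A y⟩_A = (A x)(y)` and not the norm of the
antidual. -/
def RanSpace (A : E →ₗ.[ℂ] Antidual E) (_hA : IsPositiveOp A) (_hS : IsSchwarzBounded A) : Type _ :=
  LinearMap.range A.toFun

namespace RanSpace

variable {A : E →ₗ.[ℂ] Antidual E} {hA : IsPositiveOp A} {hS : IsSchwarzBounded A}

instance instAddCommGroup : AddCommGroup (RanSpace A hA hS) :=
  inferInstanceAs (AddCommGroup (LinearMap.range A.toFun))

instance instModule : Module ℂ (RanSpace A hA hS) :=
  inferInstanceAs (Module ℂ (LinearMap.range A.toFun))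

variable (A hA hS) in
/-- The operator `A` as a linear map of its domain onto `ran A`. -/
def mk : A.domain →ₗ[ℂ] RanSpace A hA hS := A.toFun.rangeRestrict

variable (A hA hS) in
theorem mk_surjective : Function.Surjective (mk A hA hS) := A.toFun.surjective_rangeRestrict

theorem mk_eq_zero_iff (x : A.domain) : mk A hA hS x = 0 ↔ A x = 0 := by
  refine ⟨fun h => ?_, fun h => Subtype.ext h⟩
  exact congrArg (fun u : LinearMap.range A.toFun => (u : Antidual E)) h

/-- A vector in the domain of `A` that `A` sends to the given element of `ran A`. -/
def rep (u : RanSpace A hA hS) : A.domain := (mk_surjective A hA hS u).choose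

theorem mk_rep (u : RanSpace A hA hS) : mk A hA hS (rep u) = u :=
  (mk_surjective A hA hS u).choose_spec

theorem apply_rep_mk (x : A.domain) : A (rep (mk A hA hS x)) = A x := by
  have h := mk_rep (mk A hA hS x)
  exact congrArg (fun u : LinearMap.range A.toFun => (u : Antidual E)) h

/-- The inner product of `ran A`. It is conjugate-linear in the first variable, as everywhere in
Mathlib: `inner ℂ (A x) (A y) = (A y)(x)`; see `inner_mk_mk`. -/
instance instInner : Inner ℂ (RanSpace A hA hS) :=
  ⟨fun u v => A (rep v) (rep u : E)⟩

theorem inner_mk_mk (x y : A.domain) :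
    inner ℂ (mk A hA hS x) (mk A hA hS y) = A y (x : E) := by
  change A (rep (mk A hA hS y)) (rep (mk A hA hS x) : E) = A y (x : E)
  rw [apply_rep_mk, hA.symm, apply_rep_mk, ← hA.symm]

variable (A hA hS) in
/-- The axioms of an inner product. -/
@[reducible]
def core : InnerProductSpace.Core ℂ (RanSpace A hA hS) where
  inner := inner ℂ
  conj_inner_symm u v := by
    obtain ⟨x, rfl⟩ := mk_surjective A hA hS u
    obtain ⟨y, rfl⟩ := mk_surjective A hA hS v
    rw [inner_mk_mk, inner_mk_mk, ← hA.symm]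
  re_inner_nonneg u := by
    obtain ⟨x, rfl⟩ := mk_surjective A hA hS u
    rw [inner_mk_mk]
    exact (Complex.nonneg_iff.1 (hA x)).1
  add_left u v w := by
    obtain ⟨x, rfl⟩ := mk_surjective A hA hS u
    obtain ⟨y, rfl⟩ := mk_surjective A hA hS v
    obtain ⟨z, rfl⟩ := mk_surjective A hA hS w
    rw [← map_add, inner_mk_mk, inner_mk_mk, inner_mk_mk, Submodule.coe_add, map_add]
  smul_left u v r := by
    obtain ⟨x, rfl⟩ := mk_surjective A hA hS u
    obtain ⟨y, rfl⟩ := mk_surjective A hA hS v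
    rw [← map_smul, inner_mk_mk, inner_mk_mk, Submodule.coe_smul, ContinuousLinearMap.map_smulₛₗ,
      smul_eq_mul]
  definite u h := by
    obtain ⟨x, rfl⟩ := mk_surjective A hA hS u
    rw [inner_mk_mk] at h
    have h2 : ‖A x‖ ^ 2 ≤ 0 := by
      obtain ⟨K, -, hK⟩ := hS
      have h1 := hK x
      rw [h, mul_zero] at h1
      exact_mod_cast h1
    rw [mk_eq_zero_iff]
    exact norm_eq_zero.1 ((pow_eq_zero_iff two_ne_zero).1 (le_antisymm h2 (sq_nonneg _)))

instance instNormedAddCommGroup : NormedAddCommGroup (RanSpace A hA hS) :=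
  (core A hA hS).toNormedAddCommGroup

instance instInnerProductSpace : InnerProductSpace ℂ (RanSpace A hA hS) :=
  InnerProductSpace.ofCore (core A hA hS).toCore

end RanSpace

/-- The auxiliary Hilbert space `H_A` of a positive operator `A` satisfying the Schwarz-type
inequality: the completion of `ran A` in the inner product `⟨A x, A y⟩_A = (A x)(y)`. -/
abbrev AuxHilbert (A : E →ₗ.[ℂ] Antidual E) (hA : IsPositiveOp A) (hS : IsSchwarzBounded A) :
    Type _ :=
  UniformSpace.Completion (RanSpace A hA hS)

end Operators

section Functionals

variable {𝒜 : Type*} [NonUnitalNormedRing 𝒜] [NormedSpace ℂ 𝒜] [IsScalarTower ℂ 𝒜 𝒜]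
  [SMulCommClass ℂ 𝒜 𝒜] [StarRing 𝒜] [StarModule ℂ 𝒜]

/-- A linear subspace `M` of the algebra is a left ideal if `x a ∈ M` for all `x` in the algebra
and all `a ∈ M`. -/
def IsLeftIdeal (M : Submodule ℂ 𝒜) : Prop :=
  ∀ (x : 𝒜) (a : 𝒜), a ∈ M → x * a ∈ M

/-- The element `x a` of the left ideal `M`, for `x` in the algebra and `a ∈ M`. -/
def IsLeftIdeal.mul {M : Submodule ℂ 𝒜} (hM : IsLeftIdeal M) (x : 𝒜) (a : M) : M :=
  ⟨x * (a : 𝒜), hM x a a.2⟩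

/-- The condition `|f(a)|² ≤ C f(a* a)` for all `a ∈ M`. As an inequality in `ℂ` it includes that
the right-hand side is real. -/
def IsCyclicBounded {M : Submodule ℂ 𝒜} (hM : IsLeftIdeal M) (f : M →ₗ[ℂ] ℂ) (C : ℝ) : Prop :=
  ∀ a : M, ((‖f a‖ ^ 2 : ℝ) : ℂ) ≤ (C : ℂ) * f (hM.mul (star (a : 𝒜)) a)

/-- For each `a ∈ M` the functional `x ↦ f(x* a)` is continuous on the algebra. -/
def HasContinuousTranslates {M : Submodule ℂ 𝒜} (hM : IsLeftIdeal M) (f : M →ₗ[ℂ] ℂ) : Prop :=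
  ∀ a : M, Continuous fun x : 𝒜 => f (hM.mul (star x) a)

/-- The operator `A`, with domain `M` and values in the antidual of the algebra, induced by `f`:
`(A a)(x) = f(x* a)`. -/
@[reducible]
def inducedOp {M : Submodule ℂ 𝒜} (hM : IsLeftIdeal M) (f : M →ₗ[ℂ] ℂ)
    (hf : HasContinuousTranslates hM f) : 𝒜 →ₗ.[ℂ] Antidual 𝒜 where
  domain := M
  toFun :=
    { toFun := fun a =>
        { toFun := fun x => f (hM.mul (star x) a)
          map_add' := fun x y => by
            rw [← map_add]
            congr 1
            exact Subtype.ext (by simp [IsLeftIdeal.mul, add_mul])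
          map_smul' := fun c x => by
            rw [← map_smul]
            congr 1
            exact Subtype.ext (by simp [IsLeftIdeal.mul, smul_mul_assoc])
          cont := hf a }
      map_add' := fun a b => by
        ext x
        change f _ = f _ + f _
        rw [← map_add]
        congr 1
        exact Subtype.ext (by simp [IsLeftIdeal.mul, mul_add])
      map_smul' := fun c a => by
        ext x
        change f _ = c • f _
        rw [← map_smul]
        congr 1
        exact Subtype.ext (by simp [IsLeftIdeal.mul, mul_smul_comm]) }

end Functionals

section Representations

variable {𝒜 : Type*} [NonUnitalNormedRing 𝒜] [NormedSpace ℂ 𝒜] [StarRing 𝒜]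
  {H : Type*} [NormedAddCommGroup H] [InnerProductSpace ℂ H] [CompleteSpace H]

/-- `ζ` is a (topologically) cyclic vector of the representation `π` on the Hilbert space `H`:
the set of all `π(x) ζ`, with `x` in the algebra, is dense in `H`. -/
def IsCyclicVector (π : 𝒜 →⋆ₙₐ[ℂ] (H →L[ℂ] H)) (ζ : H) : Prop :=
  Dense (Set.range fun x : 𝒜 => π x ζ)

end Representations

end KreinVonNeumann

end

/-! For a `*`-action `L` of a Banach `*`-algebra on a pre-Hilbert space, Ford's square root lemma
(a self-adjoint `h` with `‖h‖ < 1` satisfies `1 - h = (1 - q)²` with `q` self-adjoint) gives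
`‖L x a‖² ≤ ‖x* x‖ ‖a‖²`. When the involution is not continuous, this is still enough: the open
mapping theorem for the closure of the graph of the involution provides `uₙ → x` with `uₙ* → v` and
`‖v‖ ≤ c ‖x‖`, and in the limit `‖L x a‖² ≤ ‖v x‖ ‖a‖² ≤ c ‖x‖² ‖a‖²`. For left multiplication on
the ideal and the form `f(a* b)`, this bound makes each `A a` continuous, and left multiplication
extend to the completion; the cyclic vector `ζ` represents `f` by Riesz' theorem, so that
`⟪ζ, A a⟫ = f(a)` and `π(a) ζ = A a`. -/

open scoped ComplexOrder ComplexConjugate InnerProductSpace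
open Filter Topology Metric

noncomputable section

namespace KreinVonNeumann

section SquareRoot

/-- `q` is a quasi-square root of `h`: in the unitization, `(1 - q)² = 1 - h`. -/
def IsQuasiSqrt {R : Type*} [NonUnitalRing R] (q h : R) : Prop :=
  q + q = h + q * q

theorem exists_isQuasiSqrt_norm_le {R : Type*} [NonUnitalNormedRing R] [NormedSpace ℝ R]
    [CompleteSpace R] {h : R} (hh : ‖h‖ < 1) : ∃ q : R, ‖q‖ ≤ ‖h‖ ∧ IsQuasiSqrt q h := by
  let T : R → R := fun q => (2⁻¹ : ℝ) • (h + q * q)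
  have hT_norm : ∀ q, ‖T q‖ = 2⁻¹ * ‖h + q * q‖ := fun q => by
    rw [norm_smul, Real.norm_of_nonneg (by norm_num)]
  have hT_maps : Set.MapsTo T (closedBall 0 ‖h‖) (closedBall 0 ‖h‖) := fun q hq => by
    rw [mem_closedBall_zero_iff] at hq ⊢
    have hqq : ‖q * q‖ ≤ ‖h‖ := (norm_mul_le _ _).trans (by nlinarith [norm_nonneg q])
    linarith [hT_norm q, norm_add_le h (q * q)]
  have hT_lip : LipschitzOnWith ‖h‖₊ T (closedBall 0 ‖h‖) := by
    refine LipschitzOnWith.of_dist_le_mul fun p hp q hq => ?_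
    rw [mem_closedBall_zero_iff] at hp hq
    have hsub : T p - T q = (2⁻¹ : ℝ) • (p * (p - q) + (p - q) * q) := by
      rw [← smul_sub]
      congr 1
      noncomm_ring
    rw [dist_eq_norm, dist_eq_norm, hsub, norm_smul, coe_nnnorm, Real.norm_of_nonneg (by norm_num)]
    calc 2⁻¹ * ‖p * (p - q) + (p - q) * q‖
        ≤ 2⁻¹ * (‖h‖ * ‖p - q‖ + ‖p - q‖ * ‖h‖) := by
          gcongr
          exact norm_add_le_of_le (norm_mul_le_of_le hp le_rfl) (norm_mul_le_of_le le_rfl hq)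
      _ = ‖h‖ * ‖p - q‖ := by ring
  obtain ⟨q, hq, hTq, -⟩ := ContractingWith.exists_fixedPoint' isClosed_closedBall.isComplete
    hT_maps ⟨hh, hT_lip.mapsToRestrict hT_maps⟩ (mem_closedBall_self (norm_nonneg h))
    (edist_ne_top _ _)
  refine ⟨q, mem_closedBall_zero_iff.1 hq, ?_⟩
  have h2 : (2⁻¹ : ℝ) • (h + q * q) = q := hTq
  rw [IsQuasiSqrt, ← two_smul ℝ, ← h2, smul_inv_smul₀ two_ne_zero, h2]

section Unitization

variable {Z : Type*} [NonUnitalNormedRing Z] [NormedSpace ℂ Z] [IsScalarTower ℂ Z Z]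
  [SMulCommClass ℂ Z Z]

instance : NormOneClass (WithLp 1 (Unitization ℂ Z)) :=
  ⟨by rw [WithLp.unitization_norm_def]
      change ‖(1 : Unitization ℂ Z).fst‖ + ‖(1 : Unitization ℂ Z).snd‖ = 1
      simp⟩

variable (Z) in
/-- The embedding of a Banach algebra into its unitization with the norm `‖(c, x)‖ = |c| + ‖x‖`. -/
def inrL1 : Z →ₙₐ[ℂ] WithLp 1 (Unitization ℂ Z) :=
  (WithLp.unitizationAlgEquiv ℂ).symm.toAlgHom.toNonUnitalAlgHom.comp
    (Unitization.inrNonUnitalAlgHom ℂ Z)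

theorem norm_inrL1 (x : Z) : ‖inrL1 Z x‖ = ‖x‖ := WithLp.unitization_norm_inr x

theorem inrL1_injective : Function.Injective (inrL1 Z) :=
  WithLp.unitization_isometry_inr.injective

theorem star_mem_spectrum_inrL1 [StarRing Z] [StarModule ℂ Z] {x : Z} {z : ℂ}
    (hz : z ∈ spectrum ℂ (inrL1 Z (star x))) : star z ∈ spectrum ℂ (inrL1 Z x) := by
  have hspec : ∀ y : Z, spectrum ℂ (inrL1 Z y) = spectrum ℂ (y : Unitization ℂ Z) := fun y =>
    (AlgEquiv.spectrum_eq (WithLp.unitizationAlgEquiv (𝕜 := ℂ) (A := Z) ℂ) (inrL1 Z y)).symm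
  rw [hspec, Unitization.inr_star, spectrum.map_star] at hz
  rwa [hspec]

end Unitization

variable {Z : Type*} [NonUnitalNormedCommRing Z] [NormedSpace ℂ Z] [IsScalarTower ℂ Z Z]
  [SMulCommClass ℂ Z Z] [CompleteSpace Z] [StarRing Z] [StarModule ℂ Z]

instance : NormedCommRing (WithLp 1 (Unitization ℂ Z)) where
  mul_comm x y := congrArg (WithLp.toLp 1) (mul_comm (WithLp.ofLp x) (WithLp.ofLp y))

theorem isUnit_two_sub_inrL1_add_star {q : Z} (hq : ‖q‖ < 1) :
    IsUnit (2 - inrL1 Z (q + star q)) := by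
  by_contra hnot
  obtain ⟨φ, hφ⟩ := WeakDual.CharacterSpace.exists_apply_eq_zero hnot
  have hle : ‖φ (inrL1 Z q)‖ ≤ ‖q‖ :=
    (spectrum.norm_le_norm_of_mem (AlgHom.apply_mem_spectrum φ _)).trans_eq (norm_inrL1 q)
  have hle_star : ‖φ (inrL1 Z (star q))‖ ≤ ‖q‖ := by
    rw [← norm_star, ← norm_inrL1 q]
    exact spectrum.norm_le_norm_of_mem (star_mem_spectrum_inrL1 (AlgHom.apply_mem_spectrum φ _))
  have htwo : φ (inrL1 Z q) + φ (inrL1 Z (star q)) = 2 := by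
    rw [map_sub, map_add, map_add, map_ofNat, sub_eq_zero] at hφ
    exact hφ.symm
  have h := norm_add_le (φ (inrL1 Z q)) (φ (inrL1 Z (star q)))
  rw [htwo, Complex.norm_ofNat] at h
  linarith

theorem IsQuasiSqrt.isSelfAdjoint {q h : Z} (hq : IsQuasiSqrt q h) (hq_lt : ‖q‖ < 1)
    (hh : IsSelfAdjoint h) : IsSelfAdjoint q := by
  -- The unit `2 - q - star q` kills `star q - q`, as both `q` and `star q` are roots of `h`.
  have hstar : IsQuasiSqrt (star q) h := by
    simpa only [IsQuasiSqrt, star_add, star_mul, hh.star_eq] using congrArg star hq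
  have hsub : (2 - inrL1 Z (q + star q)) * inrL1 Z (star q - q) = 0 := by
    rw [IsQuasiSqrt] at hq hstar
    have h2 : inrL1 Z (star q + star q - (q + q)) =
        inrL1 Z (star q * star q - q * q) := by rw [hq, hstar, add_sub_add_left_eq_sub]
    simp only [map_sub, map_add, map_mul] at h2 ⊢
    linear_combination h2
  rw [(isUnit_two_sub_inrL1_add_star hq_lt).mul_right_eq_zero] at hsub
  exact sub_eq_zero.1 (inrL1_injective (hsub.trans (map_zero _).symm))

end SquareRoot

section Ford

variable {𝒜 : Type*} [NonUnitalNormedRing 𝒜] [NormedSpace ℂ 𝒜] [IsScalarTower ℂ 𝒜 𝒜]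
  [SMulCommClass ℂ 𝒜 𝒜] [CompleteSpace 𝒜] [StarRing 𝒜] [StarModule ℂ 𝒜]

theorem exists_isSelfAdjoint_isQuasiSqrt {h : 𝒜} (hh : IsSelfAdjoint h) (hh_lt : ‖h‖ < 1) :
    ∃ q : 𝒜, IsSelfAdjoint q ∧ IsQuasiSqrt q h := by
  -- The bicommutant of `h` is closed and `*`-invariant even if the involution is not continuous.
  let S : NonUnitalStarSubalgebra ℂ 𝒜 := NonUnitalStarSubalgebra.centralizer ℂ
    (NonUnitalStarSubalgebra.centralizer ℂ {h} : Set 𝒜)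
  have hS : (S : Set 𝒜) = ({h} : Set 𝒜).centralizer.centralizer := by
    rw [NonUnitalStarSubalgebra.coe_centralizer_centralizer, Set.star_singleton, hh.star_eq,
      Set.union_self]
  have hS_comm : ∀ x ∈ S, ∀ y ∈ S, x * y = y * x := by
    simp only [← SetLike.mem_coe, hS]
    exact Set.centralizer_centralizer_comm_of_comm (by simp)
  have hS_mem : h ∈ S := by
    rw [← SetLike.mem_coe, hS]
    exact Set.subset_centralizer_centralizer rfl
  have hS_closed : IsClosed (S : Set 𝒜) := hS ▸ Set.isClosed_centralizer _
  have : CompleteSpace S := hS_closed.completeSpace_coe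
  let _ : NonUnitalNormedCommRing S :=
    { (inferInstance : NonUnitalNormedRing S) with
      mul_comm := fun x y => Subtype.ext (hS_comm x x.2 y y.2) }
  obtain ⟨q, hq_le, hq⟩ := exists_isQuasiSqrt_norm_le (h := (⟨h, hS_mem⟩ : S)) hh_lt
  have hq_sa := hq.isSelfAdjoint (hq_le.trans_lt hh_lt) (Subtype.ext hh)
  exact ⟨q, congrArg Subtype.val hq_sa, congrArg Subtype.val hq⟩

end Ford

section Actions

theorem exists_tendsto_apply_norm_le {𝕜 E F : Type*} [NontriviallyNormedField 𝕜]
    [NormedAddCommGroup E] [NormedSpace 𝕜 E] [CompleteSpace E] [NormedAddCommGroup F]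
    [NormedSpace 𝕜 F] [CompleteSpace F] (T : E →ₗ[𝕜] F) :
    ∃ c : ℝ, 0 < c ∧ ∀ x, ∃ v, ‖v‖ ≤ c * ‖x‖ ∧ ∃ u : ℕ → E,
      Tendsto u atTop (𝓝 x) ∧ Tendsto (fun n => T (u n)) atTop (𝓝 v) := by
  let G : Submodule 𝕜 (E × F) := T.graph.topologicalClosure
  have : CompleteSpace G := T.graph.isClosed_topologicalClosure.completeSpace_coe
  let P : G →L[𝕜] E := (ContinuousLinearMap.fst 𝕜 E F).comp G.subtypeL
  have hP : Function.Surjective P := fun x =>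
    ⟨⟨(x, T x), T.graph.le_topologicalClosure ((LinearMap.mem_graph_iff _ _).2 rfl)⟩, rfl⟩
  obtain ⟨c, hc, H⟩ := P.exists_preimage_norm_le hP
  refine ⟨c, hc, fun x => ?_⟩
  obtain ⟨⟨⟨x, v⟩, hG⟩, rfl, hle⟩ := H x
  obtain ⟨w, hw, hlim⟩ := mem_closure_iff_seq_limit.1 hG
  have hw' : ∀ n, T (w n).1 = (w n).2 := fun n => ((LinearMap.mem_graph_iff _ _).1 (hw n)).symm
  rw [nhds_prod_eq, Filter.tendsto_prod_iff'] at hlim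
  exact ⟨v, (norm_snd_le (x, v)).trans hle, fun n => (w n).1, hlim.1,
    by simpa only [hw'] using hlim.2⟩

variable {𝒜 : Type*} [NonUnitalNormedRing 𝒜] [NormedSpace ℂ 𝒜] [StarRing 𝒜]
  {X : Type*} [SeminormedAddCommGroup X] [InnerProductSpace ℂ X]
  {L : 𝒜 →ₙₐ[ℂ] Module.End ℂ X}

/-- An action `L` of a `*`-algebra on a pre-Hilbert space, by operators not assumed bounded, is a
`*`-action if `L (star x)` is a formal adjoint of `L x`. -/
def IsStarAction (L : 𝒜 →ₙₐ[ℂ] Module.End ℂ X) : Prop :=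
  ∀ x a b, ⟪L x a, b⟫_ℂ = ⟪a, L (star x) b⟫_ℂ

theorem IsStarAction.re_inner_star_mul_self (hL : IsStarAction L) (x : 𝒜) (a : X) :
    (⟪L (star x * x) a, a⟫_ℂ).re = ‖L x a‖ ^ 2 := by
  rw [map_mul, Module.End.mul_apply, hL, star_star]
  exact inner_self_eq_norm_sq (𝕜 := ℂ) (L x a)

theorem IsStarAction.re_inner_le_of_isQuasiSqrt (hL : IsStarAction L) {q h : 𝒜}
    (hq : IsSelfAdjoint q) (hqh : IsQuasiSqrt q h) (a : X) : (⟪L h a, a⟫_ℂ).re ≤ ‖a‖ ^ 2 := by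
  have hsq : (⟪L (q * q) a, a⟫_ℂ).re = ‖L q a‖ ^ 2 := by
    simpa only [hq.star_eq] using hL.re_inner_star_mul_self q a
  have hsum : 2 * (⟪L q a, a⟫_ℂ).re = (⟪L h a, a⟫_ℂ).re + ‖L q a‖ ^ 2 := by
    have := congrArg (fun x => (⟪L x a, a⟫_ℂ).re) hqh
    simp only [map_add, LinearMap.add_apply, inner_add_left, Complex.add_re, hsq] at this
    rwa [two_mul]
  have hdiff := norm_sub_sq (𝕜 := ℂ) (L q a) a
  rw [RCLike.re_eq_complex_re] at hdiff
  linarith [sq_nonneg ‖L q a - a‖]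

theorem IsStarAction.norm_apply_star_le (hL : IsStarAction L) {x : 𝒜} {K : ℝ}
    (hx : ∀ a, ‖L x a‖ ≤ K * ‖a‖) (a : X) : ‖L (star x) a‖ ≤ K * ‖a‖ := by
  have hmul : ‖L (star x) a‖ * ‖L (star x) a‖ ≤ K * ‖a‖ * ‖L (star x) a‖ :=
    calc ‖L (star x) a‖ * ‖L (star x) a‖ = (⟪L x (L (star x) a), a⟫_ℂ).re := by
          rw [hL, ← pow_two]
          exact (inner_self_eq_norm_sq (𝕜 := ℂ) _).symm
      _ ≤ ‖L x (L (star x) a)‖ * ‖a‖ := re_inner_le_norm (𝕜 := ℂ) _ _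
      _ ≤ K * ‖L (star x) a‖ * ‖a‖ := by gcongr; exact hx _
      _ = K * ‖a‖ * ‖L (star x) a‖ := by ring
  rcases (norm_nonneg (L (star x) a)).eq_or_lt with h0 | h0
  · exact h0 ▸ (norm_nonneg _).trans (hx a)
  · exact le_of_mul_le_mul_right hmul h0

variable [CompleteSpace 𝒜] [IsScalarTower ℂ 𝒜 𝒜] [SMulCommClass ℂ 𝒜 𝒜] [StarModule ℂ 𝒜]

theorem IsStarAction.re_inner_le (hL : IsStarAction L) {h : 𝒜} (hh : IsSelfAdjoint h) (a : X) :
    (⟪L h a, a⟫_ℂ).re ≤ ‖h‖ * ‖a‖ ^ 2 := by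
  have hscale : ∀ c > ‖h‖, (⟪L h a, a⟫_ℂ).re ≤ c * ‖a‖ ^ 2 := fun c hc => by
    have hc0 : 0 < c := (norm_nonneg h).trans_lt hc
    have hsa : IsSelfAdjoint ((c⁻¹ : ℂ) • h) := .smul (by simp [IsSelfAdjoint]) hh
    have hlt : ‖(c⁻¹ : ℂ) • h‖ < 1 := by
      rw [norm_smul, norm_inv, Complex.norm_of_nonneg hc0.le]
      exact (inv_mul_lt_one₀ hc0).2 hc
    obtain ⟨q, hq, hqh⟩ := exists_isSelfAdjoint_isQuasiSqrt hsa hlt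
    have hle := hL.re_inner_le_of_isQuasiSqrt hq hqh a
    rw [map_smul, LinearMap.smul_apply, inner_smul_left, map_inv₀, Complex.conj_ofReal,
      ← Complex.ofReal_inv, Complex.re_ofReal_mul] at hle
    exact (inv_mul_le_iff₀ hc0).1 hle
  have hlim : Tendsto (fun c : ℝ => c * ‖a‖ ^ 2) (𝓝[>] ‖h‖) (𝓝 (‖h‖ * ‖a‖ ^ 2)) :=
    (tendsto_id.mul_const _).mono_left nhdsWithin_le_nhds
  exact ge_of_tendsto hlim (eventually_mem_nhdsWithin.mono hscale)

theorem IsStarAction.norm_apply_sq_le (hL : IsStarAction L) (x : 𝒜) (a : X) :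
    ‖L x a‖ ^ 2 ≤ ‖star x * x‖ * ‖a‖ ^ 2 := by
  rw [← hL.re_inner_star_mul_self]
  exact hL.re_inner_le (.star_mul_self x) a

theorem IsStarAction.tendsto_apply {ι : Type*} {l : Filter ι} (hL : IsStarAction L) {u : ι → 𝒜}
    {x v : 𝒜} (hu : Tendsto u l (𝓝 x)) (hu_star : Tendsto (fun n => star (u n)) l (𝓝 v)) (a : X) :
    Tendsto (fun n => L (u n) a) l (𝓝 (L x a)) := by
  rw [tendsto_iff_norm_sub_tendsto_zero]
  have hbound : ∀ n, ‖L (u n) a - L x a‖ ^ 2 ≤ ‖(star (u n) - star x) * (u n - x)‖ * ‖a‖ ^ 2 :=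
    fun n => by
      rw [← star_sub, ← LinearMap.sub_apply, ← map_sub]
      exact hL.norm_apply_sq_le _ a
  have hzero : Tendsto (fun n => ‖(star (u n) - star x) * (u n - x)‖ * ‖a‖ ^ 2) l (𝓝 0) := by
    simpa using (((hu_star.sub_const (star x)).mul (hu.sub_const x)).norm).mul_const (‖a‖ ^ 2)
  simpa using (squeeze_zero (fun n => sq_nonneg _) hbound hzero).sqrt

theorem IsStarAction.norm_apply_sq_le_of_tendsto {ι : Type*} {l : Filter ι} [l.NeBot]
    (hL : IsStarAction L) {u : ι → 𝒜} {x v : 𝒜} (hu : Tendsto u l (𝓝 x))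
    (hu_star : Tendsto (fun n => star (u n)) l (𝓝 v)) (a : X) :
    ‖L x a‖ ^ 2 ≤ ‖v * x‖ * ‖a‖ ^ 2 :=
  le_of_tendsto_of_tendsto' ((hL.tendsto_apply hu hu_star a).norm.pow 2)
    ((hu_star.mul hu).norm.mul_const _) fun n => hL.norm_apply_sq_le (u n) a

theorem IsStarAction.exists_norm_apply_le (hL : IsStarAction L) :
    ∃ K : ℝ, 0 ≤ K ∧ ∀ x a, ‖L x a‖ ≤ K * ‖x‖ * ‖a‖ := by
  let starₗ : 𝒜 →ₗ[ℝ] 𝒜 :=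
    { toFun := star, map_add' := star_add, map_smul' := fun r x => by simp }
  obtain ⟨c, hc, H⟩ := exists_tendsto_apply_norm_le starₗ
  refine ⟨√c, Real.sqrt_nonneg c, fun x a => ?_⟩
  obtain ⟨v, hv, u, hu, hu_star⟩ := H x
  refine le_of_sq_le_sq ?_ (by positivity)
  calc ‖L x a‖ ^ 2 ≤ ‖v * x‖ * ‖a‖ ^ 2 := hL.norm_apply_sq_le_of_tendsto hu hu_star a
    _ ≤ c * ‖x‖ * ‖x‖ * ‖a‖ ^ 2 := by gcongr; exact norm_mul_le_of_le hv le_rfl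
    _ = (√c * ‖x‖ * ‖a‖) ^ 2 := by rw [mul_pow, mul_pow, Real.sq_sqrt hc.le]; ring

end Actions

section Forms

variable {V : Type*} [AddCommGroup V] [Module ℂ V] {B : V →ₗ⋆[ℂ] V →ₗ[ℂ] ℂ}

theorem isSymm_of_isNonneg (hB : B.IsNonneg) : B.IsSymm := by
  have him : ∀ a, (B a a).im = 0 := fun a => (Complex.nonneg_iff.1 (hB.nonneg a)).2.symm
  refine ⟨fun a b => ?_⟩
  have hadd : (B a b).im + (B b a).im = 0 := by simpa [him] using him (a + b)
  have hadd_I : -(B a b).re + (B b a).re = 0 := by simpa [him] using him (Complex.I • a + b)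
  refine Complex.ext ?_ ?_
  · rw [Complex.conj_re]; linarith
  · rw [Complex.conj_im]; linarith

/-- The pre-inner product given by a nonnegative sesquilinear form. -/
@[reducible]
def preInnerCore (hB : B.IsNonneg) : PreInnerProductSpace.Core ℂ V where
  inner a b := B a b
  conj_inner_symm a b := (isSymm_of_isNonneg hB).eq b a
  re_inner_nonneg a := (Complex.nonneg_iff.1 (hB.nonneg a)).1
  add_left a b c := by rw [map_add, LinearMap.add_apply]
  smul_left a b r := by rw [map_smulₛₗ, LinearMap.smul_apply, smul_eq_mul]

/-- The seminorm `√B(a, a)` of a nonnegative sesquilinear form `B`. -/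
def formNorm (B : V →ₗ⋆[ℂ] V →ₗ[ℂ] ℂ) (a : V) : ℝ := √(B a a).re

theorem norm_eq_formNorm {H : Type*} [NormedAddCommGroup H] [InnerProductSpace ℂ H]
    {e : V →ₗ[ℂ] H} (hinner : ∀ a b, ⟪e a, e b⟫_ℂ = B a b) (a : V) : ‖e a‖ = formNorm B a := by
  rw [formNorm, ← hinner, norm_eq_sqrt_re_inner (𝕜 := ℂ)]
  rfl

theorem exists_formNorm_apply_le {𝒜 : Type*} [NonUnitalNormedRing 𝒜] [NormedSpace ℂ 𝒜]
    [IsScalarTower ℂ 𝒜 𝒜] [SMulCommClass ℂ 𝒜 𝒜] [CompleteSpace 𝒜] [StarRing 𝒜] [StarModule ℂ 𝒜]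
    (hB : B.IsNonneg) {L : 𝒜 →ₙₐ[ℂ] Module.End ℂ V}
    (hL : ∀ x a b, B (L x a) b = B a (L (star x) b)) :
    ∃ K : ℝ, 0 ≤ K ∧ ∀ x a, formNorm B (L x a) ≤ K * ‖x‖ * formNorm B a ∧
      formNorm B (L (star x) a) ≤ K * ‖x‖ * formNorm B a := by
  let _ : SeminormedAddCommGroup V :=
    InnerProductSpace.Core.toSeminormedAddCommGroup (c := preInnerCore hB)
  let _ : InnerProductSpace ℂ V := InnerProductSpace.ofCore (preInnerCore hB)
  have hL' : IsStarAction L := hL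
  obtain ⟨K, hK, H⟩ := hL'.exists_norm_apply_le
  exact ⟨K, hK, fun x a => ⟨H x a, hL'.norm_apply_star_le (H x) a⟩⟩

end Forms

section Extension

variable {𝒜 : Type*} [NonUnitalNormedRing 𝒜] [NormedSpace ℂ 𝒜] [StarRing 𝒜]
  {E : Type*} [AddCommGroup E] [Module ℂ E]
  {H : Type*} [NormedAddCommGroup H] [InnerProductSpace ℂ H] [CompleteSpace H]

theorem exists_nonUnitalStarAlgHom_extending (L : 𝒜 →ₙₐ[ℂ] Module.End ℂ E) {e : E →ₗ[ℂ] H}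
    (he : DenseRange e) (hbd : ∀ x, ∃ K : ℝ, ∀ a, ‖e (L x a)‖ ≤ K * ‖e a‖)
    (hL : ∀ x a b, ⟪e (L x a), e b⟫_ℂ = ⟪e a, e (L (star x) b)⟫_ℂ) :
    ∃ π : 𝒜 →⋆ₙₐ[ℂ] (H →L[ℂ] H), ∀ x a, π x (e a) = e (L x a) := by
  let P : 𝒜 → H →L[ℂ] H := fun x => (e ∘ₗ L x).extendOfNorm e
  have hP : ∀ x a, P x (e a) = e (L x a) := fun x a => LinearMap.extendOfNorm_eq he (hbd x) a
  have hext : ∀ S T : H →L[ℂ] H, (∀ a, S (e a) = T (e a)) → S = T := fun S T h =>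
    ContinuousLinearMap.coeFn_injective (he.equalizer S.continuous T.continuous (funext h))
  refine ⟨{ toFun := P
            map_smul' := fun c x => hext _ _ fun a => by simp [hP]
            map_zero' := hext _ _ fun a => by simp [hP]
            map_add' := fun x y => hext _ _ fun a => by simp [hP]
            map_mul' := fun x y => hext _ _ fun a => by simp [hP]
            map_star' := fun x => ?_ }, hP⟩
  rw [ContinuousLinearMap.star_eq_adjoint, ContinuousLinearMap.eq_adjoint_iff]
  intro u v
  refine he.induction_on₂ (p := fun u v => ⟪P (star x) u, v⟫_ℂ = ⟪u, P x v⟫_ℂ)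
    (isClosed_eq (by fun_prop) (by fun_prop)) (fun a b => ?_) u v
  rw [hP, hP, hL, star_star]

end Extension

section Functionals

variable {𝒜 : Type*} [NonUnitalNormedRing 𝒜] [NormedSpace ℂ 𝒜] [IsScalarTower ℂ 𝒜 𝒜]
  [SMulCommClass ℂ 𝒜 𝒜] [StarRing 𝒜] [StarModule ℂ 𝒜] {M : Submodule ℂ 𝒜}

/-- Left multiplication of the algebra on a left ideal. -/
def IsLeftIdeal.leftMul (hM : IsLeftIdeal M) : 𝒜 →ₙₐ[ℂ] Module.End ℂ M where
  toFun x :=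
    { toFun := hM.mul x
      map_add' := fun _ _ => Subtype.ext (mul_add _ _ _)
      map_smul' := fun _ _ => Subtype.ext (mul_smul_comm _ _ _) }
  map_smul' _ _ := LinearMap.ext fun _ => Subtype.ext (smul_mul_assoc _ _ _)
  map_zero' := LinearMap.ext fun _ => Subtype.ext (zero_mul _)
  map_add' _ _ := LinearMap.ext fun _ => Subtype.ext (add_mul _ _ _)
  map_mul' _ _ := LinearMap.ext fun _ => Subtype.ext (mul_assoc _ _ _)

/-- The sesquilinear pairing `(x, a) ↦ f(x* a)` of the algebra with a left ideal. -/
def IsLeftIdeal.pairing (hM : IsLeftIdeal M) (f : M →ₗ[ℂ] ℂ) : 𝒜 →ₗ⋆[ℂ] M →ₗ[ℂ] ℂ where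
  toFun x := f ∘ₗ hM.leftMul (star x)
  map_add' x y := by rw [star_add, map_add, LinearMap.comp_add]
  map_smul' c x := by rw [star_smul, map_smul, LinearMap.comp_smul]; rfl

/-- The sesquilinear form `(a, b) ↦ f(a* b)` on a left ideal. -/
def IsLeftIdeal.form (hM : IsLeftIdeal M) (f : M →ₗ[ℂ] ℂ) : M →ₗ⋆[ℂ] M →ₗ[ℂ] ℂ :=
  hM.pairing f ∘ₛₗ M.subtype

theorem IsLeftIdeal.form_leftMul (hM : IsLeftIdeal M) (f : M →ₗ[ℂ] ℂ) (x : 𝒜) (a b : M) :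
    hM.form f (hM.leftMul x a) b = hM.form f a (hM.leftMul (star x) b) :=
  congrArg f (Subtype.ext (by simp [IsLeftIdeal.leftMul, IsLeftIdeal.mul, mul_assoc]))

variable {hM : IsLeftIdeal M} {f : M →ₗ[ℂ] ℂ} {C : ℝ}

theorem IsCyclicBounded.isNonneg_form (hC : 0 ≤ C) (hf : IsCyclicBounded hM f C) :
    (hM.form f).IsNonneg := by
  refine ⟨fun a => ?_⟩
  have hle : ((‖f a‖ ^ 2 : ℝ) : ℂ) ≤ C * hM.form f a a := hf a
  rcases hC.eq_or_lt with rfl | hC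
  · have hzero : ∀ b, f b = 0 := fun b => by
      have hsq : ((‖f b‖ ^ 2 : ℝ) : ℂ) ≤ 0 := by
        simpa only [Complex.ofReal_zero, zero_mul] using hf b
      exact norm_eq_zero.1 (sq_nonpos_iff _ |>.1 (by exact_mod_cast hsq))
    exact (hzero _).ge
  · have hnonneg : (0 : ℂ) ≤ C * hM.form f a a := le_trans (by positivity) hle
    exact le_of_mul_le_mul_left (by rwa [mul_zero]) (Complex.zero_lt_real.2 hC)

theorem IsCyclicBounded.isPositiveOp (hC : 0 ≤ C) (hf : IsCyclicBounded hM f C)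
    (hcont : HasContinuousTranslates hM f) : IsPositiveOp (inducedOp hM f hcont) :=
  (hf.isNonneg_form hC).nonneg

theorem IsCyclicBounded.norm_le (hC : 0 ≤ C) (hf : IsCyclicBounded hM f C) (a : M) :
    ‖f a‖ ≤ √C * formNorm (hM.form f) a := by
  have hre := (Complex.le_def.1 (hf a)).1
  rw [Complex.ofReal_re, Complex.re_ofReal_mul] at hre
  rw [formNorm, ← Real.sqrt_mul hC]
  exact Real.le_sqrt_of_sq_le hre

variable [CompleteSpace 𝒜]

theorem IsCyclicBounded.exists_norm_pairing_le (hC : 0 ≤ C) (hf : IsCyclicBounded hM f C) :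
    ∃ K : ℝ, 0 ≤ K ∧ ∀ x a, ‖hM.pairing f x a‖ ≤ K * formNorm (hM.form f) a * ‖x‖ := by
  obtain ⟨K, hK, H⟩ := exists_formNorm_apply_le (hf.isNonneg_form hC) (hM.form_leftMul f)
  refine ⟨√C * K, by positivity, fun x a => ?_⟩
  calc ‖f (hM.leftMul (star x) a)‖ ≤ √C * formNorm (hM.form f) (hM.leftMul (star x) a) :=
        hf.norm_le hC _
    _ ≤ √C * (K * ‖x‖ * formNorm (hM.form f) a) := by gcongr; exact (H x a).2
    _ = √C * K * formNorm (hM.form f) a * ‖x‖ := by ring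

theorem IsCyclicBounded.hasContinuousTranslates (hC : 0 ≤ C) (hf : IsCyclicBounded hM f C) :
    HasContinuousTranslates hM f := by
  obtain ⟨K, -, H⟩ := hf.exists_norm_pairing_le hC
  exact fun a => AddMonoidHomClass.continuous_of_bound ((hM.pairing f).flip a) _ fun x => H x a

theorem IsCyclicBounded.isSchwarzBounded (hC : 0 ≤ C) (hf : IsCyclicBounded hM f C)
    (hcont : HasContinuousTranslates hM f) : IsSchwarzBounded (inducedOp hM f hcont) := by
  obtain ⟨K, hK, H⟩ := hf.exists_norm_pairing_le hC
  refine ⟨K ^ 2, sq_nonneg K, fun (a : M) => ?_⟩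
  have hnonneg : 0 ≤ hM.form f a a := (hf.isNonneg_form hC).nonneg a
  have hnorm : ‖inducedOp hM f hcont a‖ ≤ K * formNorm (hM.form f) a :=
    ContinuousLinearMap.opNorm_le_bound _ (mul_nonneg hK (Real.sqrt_nonneg _)) fun x => H x a
  have hsq : ‖inducedOp hM f hcont a‖ ^ 2 ≤ K ^ 2 * (hM.form f a a).re := by
    rw [← Real.sq_sqrt (Complex.nonneg_iff.1 hnonneg).1, ← mul_pow]
    exact pow_le_pow_left₀ (norm_nonneg _) hnorm 2
  change _ ≤ _ * hM.form f a a
  rw [Complex.eq_re_of_ofReal_le hnonneg]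
  exact_mod_cast hsq

variable {H : Type*} [NormedAddCommGroup H] [InnerProductSpace ℂ H] [CompleteSpace H]

theorem IsCyclicBounded.exists_representation (hC : 0 ≤ C) (hf : IsCyclicBounded hM f C)
    {e : M →ₗ[ℂ] H} (he : DenseRange e) (hinner : ∀ a b, ⟪e a, e b⟫_ℂ = hM.form f a b) :
    ∃ (π : 𝒜 →⋆ₙₐ[ℂ] (H →L[ℂ] H)) (ζ : H), (∀ x a, π x (e a) = e (hM.mul x a)) ∧
      IsCyclicVector π ζ ∧ ∀ a : M, f a = ⟪ζ, π (a : 𝒜) ζ⟫_ℂ := by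
  have hnorm := norm_eq_formNorm hinner
  obtain ⟨K, -, hK⟩ := exists_formNorm_apply_le (hf.isNonneg_form hC) (hM.form_leftMul f)
  obtain ⟨π, hπ⟩ := exists_nonUnitalStarAlgHom_extending hM.leftMul he
    (fun x => ⟨K * ‖x‖, fun a => by simpa only [hnorm] using (hK x a).1⟩)
    (fun x a b => by rw [hinner, hinner, hM.form_leftMul])
  have hfe : ∃ D : ℝ, ∀ a, ‖f a‖ ≤ D * ‖e a‖ :=
    ⟨√C, fun a => by simpa only [hnorm] using hf.norm_le hC a⟩
  let ζ : H := (InnerProductSpace.toDual ℂ H).symm (f.extendOfNorm e)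
  have hζ : ∀ a, ⟪ζ, e a⟫_ℂ = f a := fun a => by
    rw [InnerProductSpace.toDual_symm_apply, LinearMap.extendOfNorm_eq he hfe]
  have hπζ : ∀ a : M, π a ζ = e a := fun a => he.eq_of_inner_left ℂ fun b =>
    calc ⟪π a ζ, e b⟫_ℂ = ⟪ζ, π (star (a : 𝒜)) (e b)⟫_ℂ := by
          rw [map_star, ContinuousLinearMap.star_eq_adjoint,
            ContinuousLinearMap.adjoint_inner_right]
      _ = f (hM.leftMul (star (a : 𝒜)) b) := by rw [hπ, hζ]
      _ = ⟪e a, e b⟫_ℂ := (hinner a b).symm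
  refine ⟨π, ζ, hπ, he.mono ?_, fun a => by rw [hπζ, hζ]⟩
  rintro _ ⟨a, rfl⟩
  exact ⟨a, hπζ a⟩

end Functionals

end KreinVonNeumann

end

open KreinVonNeumann in
/-- Mathlib's inner product is linear in the second variable, so `inner ℂ ζ (π a ζ)` is
`⟨π(a) ζ, ζ⟩` in the convention where it is linear in the first. -/
theorem theorem5p3 {𝒜 : Type*} [NonUnitalNormedRing 𝒜] [CompleteSpace 𝒜] [NormedSpace ℂ 𝒜]
    [IsScalarTower ℂ 𝒜 𝒜] [SMulCommClass ℂ 𝒜 𝒜] [StarRing 𝒜] [StarModule ℂ 𝒜]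
    (M : Submodule ℂ 𝒜) (hM : IsLeftIdeal M) (f : M →ₗ[ℂ] ℂ)
    (C : ℝ) (hC : 0 ≤ C) (hf : IsCyclicBounded hM f C) :
    ∃ (hcont : HasContinuousTranslates hM f)
      (hA : IsPositiveOp (inducedOp hM f hcont))
      (hS : IsSchwarzBounded (inducedOp hM f hcont))
      (π : 𝒜 →⋆ₙₐ[ℂ] (AuxHilbert (inducedOp hM f hcont) hA hS →L[ℂ]
        AuxHilbert (inducedOp hM f hcont) hA hS))
      (ζ : AuxHilbert (inducedOp hM f hcont) hA hS),
      (∀ (x : 𝒜) (a : M),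
        π x (RanSpace.mk (inducedOp hM f hcont) hA hS a : AuxHilbert _ hA hS) =
          (RanSpace.mk (inducedOp hM f hcont) hA hS (hM.mul x a) : AuxHilbert _ hA hS)) ∧
      IsCyclicVector π ζ ∧
      ∀ a : M, f a = inner ℂ ζ (π (a : 𝒜) ζ) := by
  have hcont := hf.hasContinuousTranslates hC
  have hA := hf.isPositiveOp hC hcont
  have hS := hf.isSchwarzBounded hC hcont
  let e : M →ₗ[ℂ] AuxHilbert (inducedOp hM f hcont) hA hS :=
    UniformSpace.Completion.toComplₗᵢ.toLinearMap ∘ₗ RanSpace.mk (inducedOp hM f hcont) hA hS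
  have he : DenseRange e := UniformSpace.Completion.denseRange_coe.comp
    (RanSpace.mk_surjective (inducedOp hM f hcont) hA hS).denseRange
    (UniformSpace.Completion.continuous_coe _)
  have hinner : ∀ a b : M, ⟪e a, e b⟫_ℂ = hM.form f a b := fun a b =>
    (UniformSpace.Completion.inner_coe _ _).trans (RanSpace.inner_mk_mk (hA := hA) (hS := hS) a b)
  exact ⟨hcont, hA, hS, hf.exists_representation hC he hinner⟩
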